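/- **Setting.** Let $M$ be a smooth compact $n$-dimensional manifold, with or without boundary, with a smooth Riemannian metric $g$. Let $\mathcal A=\{(U_\alpha,\phi_\alpha)\}_{\alpha\in I}$ be a finite atlas of $M$ by smooth charts $\phi_\alpha=(x^1,\dots,x^n):U_\alpha\to\mathbb R^n$ (diffeomorphisms of open sets $U_\alpha\subset M$ onto their images) that is compatible with unfolding: for every $\varepsilon$ in a fixed non-empty set of positive scales and all $\alpha,\beta$ with $U_\alpha\cap U_\beta\neq\emptyset$ there is $k(\varepsilon)\in\mathbb Z^n$ with $\phi_\alpha=\phi_\beta+\varepsilon\,k(\varepsilon)$ on $U_\alpha\cap U_\beta$. For $x\in U_\alpha$ let $g_{ij}(x)=g(\partial/\partial x^i,\partial/\partial x^j)(x)$, and let $(g^{ij}(x))$ be the inverse matrix. Let $Y=[0,1)^n$ with the topology of the torus. For $x\in U_\alpha$ equip $Y$ with the metric $g_Y^{(x)}=\sum_{i,j}g_{ij}(x)\,dy^i\otimes dy^j$, whose gradient is $\nabla_Y^{(x)}\varphi=\sum_{k,l}g^{kl}(x)\frac{\partial\varphi}{\partial y^l}\frac{\partial}{\partial y^k}$. Let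 $D:Y\to\mathbb R$ be continuous and periodic with $0<d_0\le D\le D_0$ for constants $d_0,D_0$. Let $H^1_\#(Y)$ be the Hilbert space of periodic functions in $L^2(Y)$ with weak first derivatives in $L^2(Y)$, and let $H^1_\#(Y)/\mathbb R$ be its quotient by the constants, with the quotient norm. **Cell problem.** For $x\in U_\alpha$ and $i=1,\dots,n$, find $w\in H^1_\#(Y)/\mathbb R$ that solves $-\operatorname{div}_Y^{(x)}\big(D\,\nabla_Y^{(x)}w\big)=\operatorname{div}_Y^{(x)}\big(D\,\tfrac{\partial}{\partial y^i}\big)$ in $Y$ with periodic boundary conditions in the weak sense, i.e. $$\int_Y D\,g_Y^{(x)}\big(\nabla_Y^{(x)}w,\nabla_Y^{(x)}\varphi\big)\,dy=-\int_Y D\,g_Y^{(x)}\big(\tfrac{\partial}{\partial y^i},\nabla_Y^{(x)}\varphi\big)\,dy\qquad\text{for all }\varphi\in H^1_\#(Y)/\mathbb R .$$ **Theorem 3.4.** For every $x\in M$ and $i=1,\dots,n$ the cell problem has exactly one solution $w_i(x)\in H^1_\#(Y)/\mathbb R$, and it is the same for every chart of $\mathcal A$ whose domain contains $x$. The map $x\mapsto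 w_i(x)$ belongs to $\Omega_0^1\big(M,H^1_\#(Y)/\mathbb R\big)$, the space of continuously differentiable $0$-forms on $M$ with values in the Banach space $H^1_\#(Y)/\mathbb R$; that is, $w_i:M\to H^1_\#(Y)/\mathbb R$ is of class $C^1$ for $i=1,\dots,n$. -/

import Mathlib

open scoped Manifold ContDiff
open MeasureTheory

noncomputable section

namespace CellProblem

/-! ### The reference cell and its periodic Sobolev space -/

/-- The reference cell `Y = [0,1)^n` with the topology of the torus. -/
abbrev Cell (n : ℕ) : Type := UnitAddTorus (Fin n)

/-- Lebesgue measure `dy` on `Y` (on `ℝ/ℤ` it is the Haar measure of total mass one). -/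
def cellMeasure (n : ℕ) : Measure (Cell n) :=
  Measure.pi fun _ : Fin n => (AddCircle.haarAddCircle : Measure UnitAddCircle)

/-- The real Hilbert space `L²(Y)`. -/
abbrev CellL2 (n : ℕ) : Type := Lp ℝ 2 (cellMeasure n)

/-- Smooth `Y`-periodic functions: functions on the torus whose lift to `ℝⁿ` is smooth. -/
def IsSmoothPeriodic {n : ℕ} (φ : Cell n → ℝ) : Prop :=
  ContDiff ℝ ∞ fun y : Fin n → ℝ => φ fun i => (y i : UnitAddCircle)

/-- The classical partial derivative `∂φ/∂yⁱ` of a function on the torus. -/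
def partialDeriv {n : ℕ} (i : Fin n) (φ : Cell n → ℝ) (y : Cell n) : ℝ :=
  deriv (fun t : ℝ => φ (y + Pi.single i (t : UnitAddCircle))) 0

/-- `v` is the weak partial derivative `∂u/∂yⁱ` of the periodic function `u`. -/
def IsWeakPartial {n : ℕ} (i : Fin n) (u v : CellL2 n) : Prop :=
  ∀ φ : Cell n → ℝ, IsSmoothPeriodic φ →
    ∫ y, u y * partialDeriv i φ y ∂(cellMeasure n) = - ∫ y, v y * φ y ∂(cellMeasure n)

theorem IsSmoothPeriodic.continuous {n : ℕ} {φ : Cell n → ℝ} (h : IsSmoothPeriodic φ) :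
    Continuous φ := by
  have hq : IsOpenQuotientMap (fun y : Fin n → ℝ => fun i => (y i : UnitAddCircle)) :=
    IsOpenQuotientMap.piMap (fun _ => QuotientAddGroup.isOpenQuotientMap_mk)
  exact hq.isQuotientMap.continuous_iff.2 (ContDiff.continuous h)

theorem IsSmoothPeriodic.hasDerivAt {n : ℕ} (i : Fin n) {φ : Cell n → ℝ}
    (h : IsSmoothPeriodic φ) (y : Fin n → ℝ) (t : ℝ) :
    HasDerivAt (fun t : ℝ => φ ((fun j => (y j : UnitAddCircle)) + Pi.single i (t : UnitAddCircle)))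
      (fderiv ℝ (fun y : Fin n → ℝ => φ fun j => (y j : UnitAddCircle))
        (y + t • (Pi.single i 1 : Fin n → ℝ)) (Pi.single i 1)) t := by
  have hl : HasDerivAt (fun t : ℝ => y + t • (Pi.single i 1 : Fin n → ℝ)) (Pi.single i 1) t := by
    simpa using ((hasDerivAt_id t).smul_const (Pi.single i 1 : Fin n → ℝ)).const_add y
  have hd : HasFDerivAt (fun y : Fin n → ℝ => φ fun j => (y j : UnitAddCircle))
      (fderiv ℝ (fun y : Fin n → ℝ => φ fun j => (y j : UnitAddCircle))
        (y + t • (Pi.single i 1 : Fin n → ℝ))) (y + t • (Pi.single i 1 : Fin n → ℝ)) :=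
    ((ContDiff.differentiable h (by simp)) _).hasFDerivAt
  have e : (fun t : ℝ => φ ((fun j => (y j : UnitAddCircle)) +
      Pi.single i (t : UnitAddCircle))) =
      (fun y : Fin n → ℝ => φ fun j => (y j : UnitAddCircle)) ∘
        fun t : ℝ => y + t • (Pi.single i 1 : Fin n → ℝ) := by
    funext t
    simp only [Function.comp]
    congr 1
    funext j
    by_cases hj : j = i
    · subst hj; simp
    · simp [hj]
  rw [e]
  exact hd.comp_hasDerivAt t hl

theorem partialDeriv_coe {n : ℕ} (i : Fin n) {φ : Cell n → ℝ} (h : IsSmoothPeriodic φ)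
    (y : Fin n → ℝ) : partialDeriv i φ (fun j => (y j : UnitAddCircle)) =
      fderiv ℝ (fun y : Fin n → ℝ => φ fun j => (y j : UnitAddCircle)) y (Pi.single i 1) := by
  have := (h.hasDerivAt i y 0).deriv
  rwa [zero_smul, add_zero] at this

theorem partialDeriv_continuous {n : ℕ} (i : Fin n) {φ : Cell n → ℝ} (h : IsSmoothPeriodic φ) :
    Continuous (partialDeriv i φ) := by
  have hq : IsOpenQuotientMap (fun y : Fin n → ℝ => fun i => (y i : UnitAddCircle)) :=
    IsOpenQuotientMap.piMap (fun _ => QuotientAddGroup.isOpenQuotientMap_mk)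
  refine hq.isQuotientMap.continuous_iff.2 ?_
  have key : (partialDeriv i φ ∘ fun y : Fin n → ℝ => fun i => (y i : UnitAddCircle)) =
      fun y => fderiv ℝ (fun y : Fin n → ℝ => φ fun i => (y i : UnitAddCircle)) y
        (Pi.single i 1) := funext fun y => partialDeriv_coe i h y
  rw [key]
  exact (ContDiff.continuous_fderiv h (by simp)).clm_apply continuous_const

instance (n : ℕ) : IsProbabilityMeasure (cellMeasure n) := by
  unfold cellMeasure; infer_instance

theorem integrable_mul_continuous {n : ℕ} (u : CellL2 n) {ψ : Cell n → ℝ} (h : Continuous ψ) :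
    Integrable (fun y => u y * ψ y) (cellMeasure n) := by
  obtain ⟨C, hC⟩ := (isCompact_univ (X := Cell n)).exists_bound_of_continuousOn h.continuousOn
  exact ((Lp.memLp u).integrable (by norm_num)).mul_bdd (c := C) h.aestronglyMeasurable
    (Filter.Eventually.of_forall fun y => hC y (Set.mem_univ y))

/-- The periodic Sobolev space `H¹_#(Y)`: pairs `(u, ∇u)` of an `L²` function on the torus and its
weak gradient, with the Hilbert norm `(‖u‖² + ∑ᵢ ‖∂u/∂yⁱ‖²)^(1/2)`. -/
def H1per (n : ℕ) : Submodule ℝ (WithLp 2 (CellL2 n × PiLp 2 fun _ : Fin n => CellL2 n)) where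
  carrier := {w | ∀ i, IsWeakPartial i w.fst (w.snd i)}
  zero_mem' := by
    intro i φ _
    have key : ∀ ψ : Cell n → ℝ, ∫ y, (0 : CellL2 n) y * ψ y ∂(cellMeasure n) = 0 := by
      intro ψ
      refine integral_eq_zero_of_ae ?_
      exact Filter.Eventually.of_forall fun y => by simp
    simp only [WithLp.zero_fst, WithLp.zero_snd, PiLp.zero_apply]
    rw [key, key, neg_zero]
  add_mem' := by
    intro a b ha hb i φ hφ
    have key : ∀ (u v : CellL2 n) {ψ : Cell n → ℝ}, Continuous ψ →
        ∫ y, (u + v) y * ψ y ∂(cellMeasure n) =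
          ∫ y, u y * ψ y ∂(cellMeasure n) + ∫ y, v y * ψ y ∂(cellMeasure n) := by
      intro u v ψ hψ
      rw [← integral_add (integrable_mul_continuous u hψ) (integrable_mul_continuous v hψ)]
      refine integral_congr_ae ?_
      filter_upwards [Lp.coeFn_add u v] with y hy
      rw [hy, Pi.add_apply, add_mul]
    have h1 := ha i φ hφ
    have h2 := hb i φ hφ
    simp only [WithLp.add_fst, WithLp.add_snd, PiLp.add_apply]
    rw [key _ _ (partialDeriv_continuous i hφ), key _ _ hφ.continuous, h1, h2, neg_add]
  smul_mem' := by
    intro c a ha i φ hφ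
    have key : ∀ (u : CellL2 n) (ψ : Cell n → ℝ),
        ∫ y, (c • u) y * ψ y ∂(cellMeasure n) = c * ∫ y, u y * ψ y ∂(cellMeasure n) := by
      intro u ψ
      rw [← integral_const_mul]
      refine integral_congr_ae ?_
      filter_upwards [Lp.coeFn_smul c u] with y hy
      rw [hy, Pi.smul_apply, smul_eq_mul, mul_assoc]
    simp only [WithLp.smul_fst, WithLp.smul_snd, PiLp.smul_apply]
    rw [key, key, ha i φ hφ, mul_neg]

theorem IsSmoothPeriodic.hasDerivAt' {n : ℕ} (i : Fin n) {φ : Cell n → ℝ}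
    (h : IsSmoothPeriodic φ) (y : Cell n) (t : ℝ) :
    HasDerivAt (fun t : ℝ => φ (y + Pi.single i (t : UnitAddCircle)))
      (partialDeriv i φ (y + Pi.single i (t : UnitAddCircle))) t := by
  obtain ⟨z, rfl⟩ : ∃ z : Fin n → ℝ, (fun j => (z j : UnitAddCircle)) = y :=
    ⟨fun j => Quotient.out (y j), funext fun j => Quotient.out_eq (y j)⟩
  have e : (fun j => (z j : UnitAddCircle)) + Pi.single i (t : UnitAddCircle) =
      fun j => (((z + t • (Pi.single i 1 : Fin n → ℝ)) j : ℝ) : UnitAddCircle) := by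
    funext j
    by_cases hj : j = i
    · subst hj; simp
    · simp [hj]
  have e2 := partialDeriv_coe i h (z + t • (Pi.single i 1 : Fin n → ℝ))
  rw [← e] at e2
  rw [e2]
  exact h.hasDerivAt i z t

instance (n : ℕ) : (cellMeasure n).IsAddRightInvariant := by
  unfold cellMeasure; infer_instance

theorem hasDerivAt_integral_of_bounded {X : Type*} [MeasurableSpace X] {μ : Measure X}
    [IsFiniteMeasure μ] {F F' : ℝ → X → ℝ} {C : ℝ} (hF : ∀ t, AEStronglyMeasurable (F t) μ)
    (hint : Integrable (F 0) μ) (hF' : AEStronglyMeasurable (F' 0) μ)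
    (hC : ∀ t y, ‖F' t y‖ ≤ C) (hd : ∀ t y, HasDerivAt (fun t => F t y) (F' t y) t) :
    HasDerivAt (fun t => ∫ y, F t y ∂μ) (∫ y, F' 0 y ∂μ) 0 :=
  (hasDerivAt_integral_of_dominated_loc_of_deriv_le (μ := μ) (F := F) (F' := F')
    (x₀ := 0) (s := Set.univ) (bound := fun _ => C) Filter.univ_mem
    (Filter.Eventually.of_forall hF) hint hF'
    (Filter.Eventually.of_forall fun y t _ => hC t y) (integrable_const C)
    (Filter.Eventually.of_forall fun y t _ => hd t y)).2

/-- The integral over the torus of a partial derivative of a smooth function vanishes. -/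
theorem integral_partialDeriv {n : ℕ} (i : Fin n) {φ : Cell n → ℝ} (h : IsSmoothPeriodic φ) :
    ∫ y, partialDeriv i φ y ∂(cellMeasure n) = 0 := by
  obtain ⟨C, hC⟩ := (isCompact_univ (X := Cell n)).exists_bound_of_continuousOn
    (partialDeriv_continuous i h).continuousOn
  have hF : ∀ z : Cell n, Continuous fun y : Cell n => φ (y + z) :=
    fun z => h.continuous.comp (continuous_add_const z)
  have hF' : ∀ z : Cell n, Continuous fun y : Cell n => partialDeriv i φ (y + z) :=
    fun z => (partialDeriv_continuous i h).comp (continuous_add_const z)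
  have key : HasDerivAt
      (fun t : ℝ => ∫ y, φ (y + Pi.single i (t : UnitAddCircle)) ∂(cellMeasure n))
      (∫ y, partialDeriv i φ (y + Pi.single i ((0 : ℝ) : UnitAddCircle)) ∂(cellMeasure n)) 0 := by
    refine hasDerivAt_integral_of_bounded (μ := cellMeasure n) (C := C)
      (F := fun (t : ℝ) y => φ (y + Pi.single i (t : UnitAddCircle)))
      (F' := fun (t : ℝ) y => partialDeriv i φ (y + Pi.single i (t : UnitAddCircle)))
      ?_ ?_ ?_ ?_ ?_
    · exact fun t => (hF _).aestronglyMeasurable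
    · exact (hF _).integrable_of_hasCompactSupport (HasCompactSupport.of_compactSpace _)
    · exact (hF' _).aestronglyMeasurable
    · exact fun t y => hC _ (Set.mem_univ _)
    · exact fun t y => h.hasDerivAt' i y t
  have hinv : ∀ t : ℝ, ∫ y, φ (y + Pi.single i (t : UnitAddCircle)) ∂(cellMeasure n) =
      ∫ y, φ y ∂(cellMeasure n) := fun t => integral_add_right_eq_self φ _
  simp only [hinv] at key
  have h0 := key.unique (hasDerivAt_const (0 : ℝ) _)
  rw [integral_add_right_eq_self (partialDeriv i φ)] at h0
  exact h0

/-- The constant function `1`, with its weak gradient `0`. -/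
def constOne (n : ℕ) : H1per n :=
  ⟨WithLp.toLp 2 (Lp.const 2 (cellMeasure n) (1 : ℝ), 0), by
    intro i φ hφ
    have e1 : ∫ y, (Lp.const 2 (cellMeasure n) (1 : ℝ)) y * partialDeriv i φ y ∂(cellMeasure n) =
        ∫ y, partialDeriv i φ y ∂(cellMeasure n) := by
      refine integral_congr_ae ?_
      filter_upwards [Lp.coeFn_const 2 (cellMeasure n) (1 : ℝ)] with y hy
      rw [hy, Function.const_apply, one_mul]
    have e2 : ∫ y, (0 : CellL2 n) y * φ y ∂(cellMeasure n) = 0 := by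
      refine integral_eq_zero_of_ae ?_
      exact Filter.Eventually.of_forall fun y => by simp
    have e3 := e1.trans (integral_partialDeriv i hφ)
    exact e3.trans (by rw [← neg_zero, ← e2]; rfl)⟩

/-- The constant functions in `H¹_#(Y)`. -/
def constants (n : ℕ) : Submodule ℝ (H1per n) := Submodule.span ℝ {constOne n}

instance (n : ℕ) : FiniteDimensional ℝ (constants n) := by
  unfold constants; infer_instance

instance (n : ℕ) : IsClosed (constants n : Set (H1per n)) :=
  Submodule.closed_of_finiteDimensional _

/-- The space `H¹_#(Y)/ℝ` with the quotient norm. -/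
abbrev H1perModConst (n : ℕ) : Type := H1per n ⧸ constants n

/-- The partial derivatives `(∂w/∂y¹, …, ∂w/∂yⁿ)` of a class `w ∈ H¹_#(Y)/ℝ`. -/
def weakGrad {n : ℕ} : H1perModConst n →ₗ[ℝ] PiLp 2 fun _ : Fin n => CellL2 n :=
  (constants n).liftQ
    { toFun := fun w => w.1.snd
      map_add' := fun _ _ => rfl
      map_smul' := fun _ _ => rfl }
    (by
      intro w hw
      obtain ⟨c, rfl⟩ := Submodule.mem_span_singleton.1 hw
      exact smul_zero c)

/-! ### Constant metrics on the cell and the cell problem -/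

/-- The scalar product `∑ᵢⱼ gᵢⱼ vⁱ wʲ` with coefficient matrix `G = (gᵢⱼ)`. -/
def metricInner {n : ℕ} (G : Matrix (Fin n) (Fin n) ℝ) (v w : Fin n → ℝ) : ℝ :=
  ∑ i, ∑ j, G i j * v i * w j

/-- The gradient vector for the metric `G` of a function with partial derivatives `p`; its
components are `∑ₗ gᵏˡ pₗ`. -/
def metricGrad {n : ℕ} (G : Matrix (Fin n) (Fin n) ℝ) (p : Fin n → ℝ) : Fin n → ℝ :=
  fun k => ∑ l, G⁻¹ k l * p l

/-- `w ∈ H¹_#(Y)/ℝ` is the (weak) solution of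
`-div (D ∇w) = div (D ∂/∂yⁱ)` in `Y`, with periodic boundary conditions, where `div` and `∇` are
taken with respect to the metric on `Y` with constant coefficients `G`. -/
def IsCellSolution {n : ℕ} (D : Cell n → ℝ) (G : Matrix (Fin n) (Fin n) ℝ) (i : Fin n)
    (w : H1perModConst n) : Prop :=
  ∀ φ : H1perModConst n,
    ∫ y, D y * metricInner G (metricGrad G fun l => weakGrad w l y)
        (metricGrad G fun l => weakGrad φ l y) ∂(cellMeasure n) =
      - ∫ y, D y * metricInner G (Pi.single i 1)
        (metricGrad G fun l => weakGrad φ l y) ∂(cellMeasure n)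

/-! ### Charts, local coefficients of a metric, atlases compatible with unfolding -/

section Manifold

variable {n : ℕ} {H : Type*} [TopologicalSpace H]
  (I : ModelWithCorners ℝ (EuclideanSpace ℝ (Fin n)) H)
  (M : Type*) [TopologicalSpace M] [ChartedSpace H M]

/-- A coordinate chart `φ : U → ℝⁿ` on an `n`-dimensional manifold (with or without boundary):
a diffeomorphism of an open set `U` onto its image in `ℝⁿ`. If `M` has a boundary, then
the image need not be open, nor be contained in a half-space. -/
structure CoordChart where
  /-- the chart domain `U` -/
  source : Set M
  /-- the coordinates; only their values on `U` matter -/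
  toFun : M → EuclideanSpace ℝ (Fin n)
  isOpen_source : IsOpen source
  isEmbedding : Topology.IsEmbedding (source.domRestrict toFun)
  contMDiffOn : ContMDiffOn I 𝓘(ℝ, EuclideanSpace ℝ (Fin n)) ∞ toFun source
  isInvertible_mfderiv : ∀ x ∈ source,
    (mfderiv I 𝓘(ℝ, EuclideanSpace ℝ (Fin n)) toFun x).IsInvertible

variable {I M}

/-- The local basis vector `∂/∂xⁱ` at the point `x`, that is, the preimage of the `i`-th unit
vector under the differential of the chart. -/
def CoordChart.basisVec (φ : CoordChart I M) (x : M) (i : Fin n) : TangentSpace I x :=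
  (mfderiv I 𝓘(ℝ, EuclideanSpace ℝ (Fin n)) φ.toFun x).inverse (EuclideanSpace.single i (1 : ℝ))

/-- The matrix of coefficients `gᵢⱼ(x) = g(∂/∂xⁱ, ∂/∂xʲ)` in the chart `φ`. -/
def CoordChart.metricCoeff [IsManifold I ∞ M] (φ : CoordChart I M)
    (g : Bundle.ContMDiffRiemannianMetric I ∞ (EuclideanSpace ℝ (Fin n))
      (fun x : M => TangentSpace I x)) (x : M) : Matrix (Fin n) (Fin n) ℝ :=
  Matrix.of fun i j => g.inner x (φ.basisVec x i) (φ.basisVec x j)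

/-- The atlas `A` is compatible with unfolding for the scales `ε ∈ S`: on every non-empty overlap
and for each scale, the two charts differ by `ε k` with an integer vector `k = k(ε)`. -/
def CompatibleWithUnfolding {ι : Type*} (A : ι → CoordChart I M) (S : Set ℝ) : Prop :=
  ∀ α β, ((A α).source ∩ (A β).source).Nonempty → ∀ ε ∈ S, ∃ k : Fin n → ℤ,
    ∀ x ∈ (A α).source ∩ (A β).source, ∀ i,
      (A α).toFun x i = (A β).toFun x i + ε * (k i : ℝ)

end Manifold

end CellProblem

end

/-!
The cell problem is a linear elliptic equation whose dependence on `x ∈ M` is only through the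
matrix `G = (gᵢⱼ(x))`, and the theorem follows from the Lax–Milgram theorem together with the
smoothness of operator inversion.

For vectors `v`, `p` one has `g(v, ∇p) = ∑ₖ vᵏ pₖ`. Hence the weak cell problem reads
`B(G⁻¹) w = -ℓᵢ` in the dual of `X = H¹_#(Y)/ℝ`, where `B(a)(w, φ) = ∫ D ∑ₖₗ aₖₗ ∂ₖw ∂ₗφ` is linear
in the matrix `a` and `ℓᵢ(φ) = ∫ D ∂ᵢφ` (`isCellSolution_iff`). If `a` is positive definite, then
`B(a)(w, w) ≥ c ‖∇w‖²`, because `D ≥ d₀ > 0`. The Poincaré inequality `‖w‖ ≤ 2 ‖∇w‖`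
(`norm_le_norm_weakGrad`), read off from Fourier coefficients, makes the weak gradient an isomorphism
of `X` onto a closed subspace of a Hilbert space, so that Lax–Milgram applies and `B(a) : X → X*` is
invertible (`isInvertible_coeffForm`). This gives existence and uniqueness, with solution
`B(G⁻¹)⁻¹ (-ℓᵢ)`, which is a smooth function of the entries of `G` (`contDiffAt_cellSolution`).

Two charts of an atlas compatible with unfolding differ by a constant on their overlap, so they have
the same coordinate vector fields and the same matrix `G` there
(`CompatibleWithUnfolding.metricCoeff_eq`). Finally `x ↦ G(x)` is continuously differentiable on a
chart domain, as the coordinate fields are pullbacks of constant vector fields under the chart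
(`CoordChart.contMDiffAt_metricCoeff`).
-/

noncomputable section

namespace CellProblem

/-! ### The Poincaré inequality on the torus -/

open UnitAddTorus

/-- Parseval's identity on the cell. -/
theorem hasSum_sq_fourierCoeff_complex {n : ℕ} (f : Lp ℂ 2 (cellMeasure n)) :
    HasSum (fun k : Fin n → ℤ => ‖∫ y, mFourier (-k) y * f y ∂(cellMeasure n)‖ ^ 2)
      (∫ y, ‖f y‖ ^ 2 ∂(cellMeasure n)) :=
  UnitAddTorus.hasSum_sq_mFourierCoeff f

/-- The `k`-th Fourier coefficient of a real function in `L²(Y)`. -/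
def cellFourierCoeff {n : ℕ} (u : CellL2 n) (k : Fin n → ℤ) : ℂ :=
  ∫ y, mFourier (-k) y * (u y : ℂ) ∂(cellMeasure n)

theorem norm_sq_eq_integral {n : ℕ} (u : CellL2 n) :
    ‖u‖ ^ 2 = ∫ y, u y ^ 2 ∂(cellMeasure n) := by
  rw [← real_inner_self_eq_norm_sq, L2.inner_def]
  refine integral_congr_ae (Filter.Eventually.of_forall fun y => ?_)
  simp [sq]

theorem hasSum_sq_cellFourierCoeff {n : ℕ} (u : CellL2 n) :
    HasSum (fun k => ‖cellFourierCoeff u k‖ ^ 2) (‖u‖ ^ 2) := by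
  have hc : ∀ᵐ y ∂(cellMeasure n), (Complex.ofRealCLM.compLp u) y = (u y : ℂ) :=
    Complex.ofRealCLM.coeFn_compLp u
  convert! hasSum_sq_fourierCoeff_complex (Complex.ofRealCLM.compLp u) using 1
  · funext k
    congr 2
    refine integral_congr_ae ?_
    filter_upwards [hc] with y hy
    rw [hy]
  · rw [norm_sq_eq_integral]
    refine integral_congr_ae ?_
    filter_upwards [hc] with y hy
    rw [hy, Complex.norm_real, Real.norm_eq_abs, sq_abs]

theorem contDiff_mFourier {n : ℕ} (k : Fin n → ℤ) :
    ContDiff ℝ ∞ fun y : Fin n → ℝ => mFourier k fun i => (y i : UnitAddCircle) := by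
  have e : (fun y : Fin n → ℝ => mFourier k fun i => (y i : UnitAddCircle)) =
      fun y => ∏ j, Complex.exp (2 * Real.pi * Complex.I * k j * Complex.ofRealCLM (y j)) := by
    funext y
    simp [mFourier]
  rw [e]
  refine contDiff_prod fun j _ => Complex.contDiff_exp.comp (contDiff_const.mul ?_)
  exact Complex.ofRealCLM.contDiff.comp (contDiff_apply ℝ ℝ j)

theorem mFourier_hasDerivAt {n : ℕ} (k : Fin n → ℤ) (i : Fin n) (y : Cell n) :
    HasDerivAt (fun t : ℝ => mFourier k (y + Pi.single i (t : UnitAddCircle)))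
      (2 * Real.pi * k i * Complex.I * mFourier k y) 0 := by
  have e : (fun t : ℝ => mFourier k (y + Pi.single i (t : UnitAddCircle))) =
      fun t : ℝ => mFourier k y * fourier (k i) (t : UnitAddCircle) := by
    funext t
    simp only [mFourier, ContinuousMap.coe_mk, Pi.add_apply, Finset.prod_mul_distrib,
      fourier_apply, smul_add, AddCircle.toCircle_add, Circle.coe_mul]
    congr 1
    rw [Finset.prod_eq_single i]
    · simp
    · intro j _ hj
      simp [hj]
    · simp
  rw [e]
  have h := (hasDerivAt_fourier 1 (k i) 0).const_mul (mFourier k y)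
  convert! h using 1
  simp
  ring

theorem mFourier_re_smooth {n : ℕ} (k : Fin n → ℤ) :
    IsSmoothPeriodic fun y : Cell n => (mFourier k y).re :=
  Complex.reCLM.contDiff.comp (contDiff_mFourier k)

theorem mFourier_im_smooth {n : ℕ} (k : Fin n → ℤ) :
    IsSmoothPeriodic fun y : Cell n => (mFourier k y).im :=
  Complex.imCLM.contDiff.comp (contDiff_mFourier k)

theorem partialDeriv_mFourier_re {n : ℕ} (k : Fin n → ℤ) (i : Fin n) (y : Cell n) :
    partialDeriv i (fun y => (mFourier k y).re) y = -(2 * Real.pi * k i) * (mFourier k y).im := by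
  have h := (Complex.reCLM.hasFDerivAt.comp_hasDerivAt (0 : ℝ) (mFourier_hasDerivAt k i y)).deriv
  refine h.trans ?_
  simp

theorem partialDeriv_mFourier_im {n : ℕ} (k : Fin n → ℤ) (i : Fin n) (y : Cell n) :
    partialDeriv i (fun y => (mFourier k y).im) y = 2 * Real.pi * k i * (mFourier k y).re := by
  have h := (Complex.imCLM.hasFDerivAt.comp_hasDerivAt (0 : ℝ) (mFourier_hasDerivAt k i y)).deriv
  refine h.trans ?_
  simp

theorem integrable_mFourier_mul {n : ℕ} (u : CellL2 n) (k : Fin n → ℤ) :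
    Integrable (fun y => mFourier k y * (u y : ℂ)) (cellMeasure n) := by
  refine (((Lp.memLp u).integrable (by norm_num)).ofReal (𝕜 := ℂ)).bdd_mul (c := 1)
    (mFourier k).continuous.aestronglyMeasurable (Filter.Eventually.of_forall fun y => ?_)
  exact ((mFourier k).norm_coe_le_norm y).trans mFourier_norm.le

theorem cellFourierCoeff_re {n : ℕ} (u : CellL2 n) (k : Fin n → ℤ) :
    (cellFourierCoeff u k).re = ∫ y, u y * (mFourier (-k) y).re ∂(cellMeasure n) := by
  have h := integral_re (integrable_mFourier_mul u (-k))
  refine h.symm.trans (integral_congr_ae (Filter.Eventually.of_forall fun y => ?_))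
  simp [mul_comm]

theorem cellFourierCoeff_im {n : ℕ} (u : CellL2 n) (k : Fin n → ℤ) :
    (cellFourierCoeff u k).im = ∫ y, u y * (mFourier (-k) y).im ∂(cellMeasure n) := by
  have h := integral_im (integrable_mFourier_mul u (-k))
  refine h.symm.trans (integral_congr_ae (Filter.Eventually.of_forall fun y => ?_))
  simp [mul_comm]

/-- The Fourier coefficients of a weak partial derivative `∂ᵢu` are, up to a factor of modulus one,
`2πkᵢ` times those of `u`. -/
theorem IsWeakPartial.norm_sq_cellFourierCoeff {n : ℕ} {i : Fin n} {u v : CellL2 n}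
    (h : IsWeakPartial i u v) (k : Fin n → ℤ) :
    ‖cellFourierCoeff v k‖ ^ 2 = (2 * Real.pi * k i) ^ 2 * ‖cellFourierCoeff u k‖ ^ 2 := by
  -- The real and imaginary parts of the monomial serve as test functions.
  have h1 := h _ (mFourier_re_smooth (-k))
  have h2 := h _ (mFourier_im_smooth (-k))
  simp only [partialDeriv_mFourier_re, partialDeriv_mFourier_im, mul_left_comm (_ : ℝ) (_ * _ : ℝ),
    mul_left_comm (_ : ℝ) (-(_ * _) : ℝ)] at h1 h2
  rw [integral_const_mul, ← cellFourierCoeff_re, ← cellFourierCoeff_im] at h1 h2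
  simp only [← Complex.normSq_eq_norm_sq, Complex.normSq_apply]
  simp only [Pi.neg_apply, Int.cast_neg] at h1 h2
  have e1 : (cellFourierCoeff v k).re = - (2 * Real.pi * k i * (cellFourierCoeff u k).im) := by
    linarith
  have e2 : (cellFourierCoeff v k).im = 2 * Real.pi * k i * (cellFourierCoeff u k).re := by
    linarith
  rw [e1, e2]
  ring

/-- The Poincaré inequality for functions of mean zero: a non-zero frequency has an entry with
`(2πkᵢ)² ≥ 1`, so that each Fourier coefficient is dominated by those of the partial
derivatives. -/
theorem norm_sq_le_of_weakPartial {n : ℕ} {u : CellL2 n} {v : Fin n → CellL2 n}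
    (h : ∀ i, IsWeakPartial i u (v i)) (h0 : ∫ y, u y ∂(cellMeasure n) = 0) :
    ‖u‖ ^ 2 ≤ ∑ i, ‖v i‖ ^ 2 := by
  refine hasSum_le (fun k => ?_) (hasSum_sq_cellFourierCoeff u)
    (hasSum_sum fun i _ => hasSum_sq_cellFourierCoeff (v i))
  by_cases hk : k = 0
  · subst hk
    have : cellFourierCoeff u 0 = 0 := by
      simp only [cellFourierCoeff, neg_zero, mFourier_zero, ContinuousMap.one_apply, one_mul]
      rw [integral_complex_ofReal, h0, Complex.ofReal_zero]
    rw [this, norm_zero, zero_pow two_ne_zero]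
    positivity
  · obtain ⟨i, hi⟩ := Function.ne_iff.1 hk
    refine le_trans ?_ (Finset.single_le_sum (f := fun i => ‖cellFourierCoeff (v i) k‖ ^ 2)
      (fun _ _ => by positivity) (Finset.mem_univ i))
    simp only [(h i).norm_sq_cellFourierCoeff k]
    refine le_mul_of_one_le_left (by positivity) ?_
    have h1 : (1 : ℝ) ≤ (k i : ℝ) ^ 2 := by
      exact_mod_cast (one_le_sq_iff_one_le_abs _).2 (Int.one_le_abs hi)
    have h2 : (1 : ℝ) ≤ (2 * Real.pi) ^ 2 := by nlinarith [Real.pi_gt_three]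
    rw [mul_pow]
    nlinarith

/-! ### Completeness of `H¹_#(Y)/ℝ` -/

/-- Integration against a continuous function is an inner product, and hence a continuous linear
functional on `L²(Y)`. -/
theorem integral_mul_eq_inner {n : ℕ} (u : CellL2 n) (ψ : C(Cell n, ℝ)) :
    ∫ y, u y * ψ y ∂(cellMeasure n) =
      inner ℝ (ContinuousMap.toLp 2 (cellMeasure n) ℝ ψ) u := by
  rw [L2.inner_def]
  refine integral_congr_ae ?_
  filter_upwards [ContinuousMap.coeFn_toLp (p := 2) (𝕜 := ℝ) (cellMeasure n) ψ] with y hy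
  rw [hy]
  simp

theorem isClosed_H1per (n : ℕ) :
    IsClosed (H1per n : Set (WithLp 2 (CellL2 n × PiLp 2 fun _ : Fin n => CellL2 n))) := by
  have e : (H1per n : Set (WithLp 2 (CellL2 n × PiLp 2 fun _ : Fin n => CellL2 n))) =
      ⋂ (i : Fin n) (φ : Cell n → ℝ) (_ : IsSmoothPeriodic φ),
        {w | ∫ y, w.fst y * partialDeriv i φ y ∂(cellMeasure n) =
          - ∫ y, w.snd i y * φ y ∂(cellMeasure n)} := by
    ext w
    simp only [Set.mem_iInter]
    rfl
  rw [e]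
  refine isClosed_iInter fun i => isClosed_iInter fun φ => isClosed_iInter fun hφ => ?_
  have h1 := fun u : CellL2 n => integral_mul_eq_inner u ⟨_, partialDeriv_continuous i hφ⟩
  have h2 := fun u : CellL2 n => integral_mul_eq_inner u ⟨_, hφ.continuous⟩
  simp only [ContinuousMap.coe_mk] at h1 h2
  simp only [h1, h2]
  refine isClosed_eq (by fun_prop) (Continuous.neg (continuous_const.inner ?_))
  exact (PiLp.continuous_apply 2 (fun _ : Fin n => CellL2 n) i).comp (by fun_prop)

instance (n : ℕ) : CompleteSpace (H1per n) := (isClosed_H1per n).completeSpace_coe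

/-! ### The Poincaré inequality on `H¹_#(Y)/ℝ` -/

/-- The weak gradient as a continuous linear map on `H¹_#(Y)/ℝ`. -/
def weakGradL (n : ℕ) : H1perModConst n →L[ℝ] PiLp 2 fun _ : Fin n => CellL2 n where
  toLinearMap := weakGrad
  cont := by
    refine (Submodule.isOpenQuotientMap_mkQ (constants n)).isQuotientMap.continuous_iff.2 ?_
    change Continuous fun w : H1per n => w.1.snd
    fun_prop

@[simp]
theorem weakGradL_apply {n : ℕ} (w : H1perModConst n) : weakGradL n w = weakGrad w := rfl

/-- The Poincaré inequality on `H¹_#(Y)/ℝ`: the quotient norm is bounded by the norm of the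
representative of mean zero. -/
theorem norm_le_norm_weakGrad {n : ℕ} (w : H1perModConst n) : ‖w‖ ≤ 2 * ‖weakGrad w‖ := by
  obtain ⟨w, rfl⟩ := Submodule.mkQ_surjective (constants n) w
  set c : ℝ := ∫ y, w.1.fst y ∂(cellMeasure n) with hc
  set w' : H1per n := w - c • constOne n with hw'
  have hq : (constants n).mkQ w = (constants n).mkQ w' := by
    refine (Submodule.Quotient.eq _).2 ?_
    rw [hw', sub_sub_cancel]
    exact Submodule.smul_mem _ _ (Submodule.mem_span_singleton_self _)
  rw [hq]
  have hfst : w'.1.fst = w.1.fst - c • Lp.const 2 (cellMeasure n) (1 : ℝ) := rfl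
  have h0 : ∫ y, w'.1.fst y ∂(cellMeasure n) = 0 := by
    have : ∫ y, w'.1.fst y ∂(cellMeasure n) = ∫ y, (w.1.fst y - c) ∂(cellMeasure n) := by
      refine integral_congr_ae ?_
      rw [hfst]
      filter_upwards [Lp.coeFn_sub w.1.fst (c • Lp.const 2 (cellMeasure n) (1 : ℝ)),
        Lp.coeFn_smul c (Lp.const 2 (cellMeasure n) (1 : ℝ)),
        Lp.coeFn_const 2 (cellMeasure n) (1 : ℝ)] with y h1 h2 h3
      rw [h1, Pi.sub_apply, h2, Pi.smul_apply, h3]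
      simp
    rw [this, integral_sub ((Lp.memLp _).integrable (by norm_num)) (integrable_const c),
      integral_const]
    simp [hc]
  have h1 : ‖w'.1.fst‖ ^ 2 ≤ ‖w'.1.snd‖ ^ 2 := by
    rw [PiLp.norm_sq_eq_of_L2]
    exact norm_sq_le_of_weakPartial w'.2 h0
  have h2 : ‖w'‖ ^ 2 = ‖w'.1.fst‖ ^ 2 + ‖w'.1.snd‖ ^ 2 := WithLp.prod_norm_sq_eq_of_L2 _
  have h3 : ‖(constants n).mkQ w'‖ ≤ ‖w'‖ := Submodule.Quotient.norm_mk_le _ _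
  have h4 : weakGrad ((constants n).mkQ w') = w'.1.snd := rfl
  rw [h4]
  refine h3.trans (abs_le_of_sq_le_sq' ?_ (by positivity)).2
  nlinarith [norm_nonneg w'.1.snd]

/-! ### The Lax–Milgram theorem on a Hilbertable space -/

/-- The Lax–Milgram theorem for a Banach space `X` whose topology is induced by an injection `T`
with closed range into a Hilbert space. -/
theorem isInvertible_of_coercive {X E : Type*} [NormedAddCommGroup X] [NormedSpace ℝ X]
    [CompleteSpace X] [NormedAddCommGroup E] [InnerProductSpace ℝ E]
    (T : X →L[ℝ] E) {C : ℝ} (hT : ∀ x, ‖x‖ ≤ C * ‖T x‖)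
    (B : X →L[ℝ] X →L[ℝ] ℝ) {c : ℝ} (hc : 0 < c) (hB : ∀ x, c * ‖T x‖ ^ 2 ≤ B x x) :
    B.IsInvertible := by
  have hanti : AntilipschitzWith C.toNNReal T :=
    AddMonoidHomClass.antilipschitz_of_bound T fun x =>
      (hT x).trans (mul_le_mul_of_nonneg_right (Real.le_coe_toNNReal C) (norm_nonneg _))
  let V : Submodule ℝ E := LinearMap.range (T : X →ₗ[ℝ] E)
  let e₀ : X ≃ₗ[ℝ] V := LinearEquiv.ofInjective (T : X →ₗ[ℝ] E) hanti.injective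
  have he₀ : ∀ x, (e₀ x : E) = T x := fun x => rfl
  let e : X ≃L[ℝ] V := e₀.toContinuousLinearEquivOfBounds ‖T‖ C
    (fun x => T.le_opNorm x)
    (fun v => by
      have := hT (e₀.symm v)
      rwa [← he₀, LinearEquiv.apply_symm_apply] at this)
  have he : ∀ x, ‖e x‖ = ‖T x‖ := fun x => rfl
  have : CompleteSpace V :=
    (completeSpace_congr (e := e.toEquiv) e.isUniformEmbedding).1 inferInstance
  let B' : V →L[ℝ] V →L[ℝ] ℝ :=
    B.bilinearComp (e.symm : V →L[ℝ] X) (e.symm : V →L[ℝ] X)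
  have hB' : IsCoercive B' := by
    refine ⟨c, hc, fun v => ?_⟩
    have := hB (e.symm v)
    rw [← he, e.apply_symm_apply] at this
    rw [mul_assoc, ← sq]
    exact this
  have hinj : Function.Injective B := by
    refine (injective_iff_map_eq_zero B).2 fun x hx => ?_
    have h1 := hB x
    rw [hx, zero_apply] at h1
    have h2 : ‖T x‖ = 0 := by
      by_contra h
      have : 0 < ‖T x‖ ^ 2 := by positivity
      nlinarith
    have h3 := hT x
    rw [h2, mul_zero] at h3
    exact norm_le_zero_iff.1 h3
  have hsurj : Function.Surjective B := by
    intro f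
    let f' : V →L[ℝ] ℝ := f.comp (e.symm : V →L[ℝ] X)
    let v := hB'.continuousLinearEquivOfBilin.symm ((InnerProductSpace.toDual ℝ V).symm f')
    refine ⟨e.symm v, ContinuousLinearMap.ext fun x => ?_⟩
    have h1 := hB'.continuousLinearEquivOfBilin_apply v (e x)
    rw [ContinuousLinearEquiv.apply_symm_apply, InnerProductSpace.toDual_symm_apply] at h1
    simpa [B', f'] using h1.symm
  exact ⟨ContinuousLinearEquiv.ofBijective B (LinearMap.ker_eq_bot.2 hinj)
    (LinearMap.range_eq_top.2 hsurj), ContinuousLinearEquiv.coe_ofBijective _ _ _⟩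

/-! ### The bilinear form of the cell problem -/

section Form

-- Named copies of the two inferred instances: they let unification find the norm on the quotient
-- when only its topology and module structure are given.
local instance normedAddCommGroupH1perModConst (n : ℕ) : NormedAddCommGroup (H1perModConst n) :=
  Submodule.Quotient.normedAddCommGroup (constants n)

local instance normedSpaceH1perModConst (n : ℕ) : NormedSpace ℝ (H1perModConst n) :=
  Submodule.Quotient.normedSpace (constants n) ℝ

variable {n : ℕ}

/-- Multiplication by a continuous function, as an operator on `L²(Y)`. -/
def mulL2 (D : C(Cell n, ℝ)) : CellL2 n →L[ℝ] CellL2 n :=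
  (ContinuousLinearMap.mul ℝ ℝ).holderL (cellMeasure n) ⊤ 2 2
    (ContinuousMap.toLp ⊤ (cellMeasure n) ℝ D)

theorem coeFn_mulL2 (D : C(Cell n, ℝ)) (u : CellL2 n) :
    ∀ᵐ y ∂(cellMeasure n), mulL2 D u y = D y * u y := by
  filter_upwards [(ContinuousLinearMap.mul ℝ ℝ).coeFn_holder (r := 2)
    (ContinuousMap.toLp ⊤ (cellMeasure n) ℝ D) u,
    ContinuousMap.coeFn_toLp (p := ⊤) (𝕜 := ℝ) (cellMeasure n) D] with y h1 h2
  rw [← h2]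
  exact h1

theorem integrable_weight_mul (D : C(Cell n, ℝ)) (u v : CellL2 n) :
    Integrable (fun y => D y * (u y * v y)) (cellMeasure n) := by
  refine (L2.integrable_inner (𝕜 := ℝ) v (mulL2 D u)).congr ?_
  filter_upwards [coeFn_mulL2 D u] with y hy
  rw [hy]
  simp [mul_assoc]

/-- The bilinear form `(x, y) ↦ ⟪S x, T y⟫`. -/
def innerForm {X E : Type*} [NormedAddCommGroup X] [NormedSpace ℝ X] [NormedAddCommGroup E]
    [InnerProductSpace ℝ E] (S T : X →L[ℝ] E) : X →L[ℝ] X →L[ℝ] ℝ :=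
  (innerSL ℝ : E →L[ℝ] E →L[ℝ] ℝ).bilinearComp S T

/-- The bilinear form `(w, φ) ↦ ∫ D ∂ₖw ∂ₗφ` on `H¹_#(Y)/ℝ`. -/
def partialForm (D : C(Cell n, ℝ)) (k l : Fin n) :
    H1perModConst n →L[ℝ] H1perModConst n →L[ℝ] ℝ :=
  innerForm (X := H1perModConst n)
    ((mulL2 D).comp ((PiLp.proj 2 (fun _ : Fin n => CellL2 n) k).comp (weakGradL n)))
    ((PiLp.proj 2 (fun _ : Fin n => CellL2 n) l).comp (weakGradL n))

theorem partialForm_apply (D : C(Cell n, ℝ)) (k l : Fin n) (w φ : H1perModConst n) :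
    partialForm D k l w φ =
      ∫ y, D y * (weakGrad w k y * weakGrad φ l y) ∂(cellMeasure n) := by
  change inner ℝ (mulL2 D (weakGrad w k)) (weakGrad φ l) = _
  rw [L2.inner_def]
  refine integral_congr_ae ?_
  filter_upwards [coeFn_mulL2 D (weakGrad w k)] with y hy
  rw [hy]
  simp
  ring

/-- The linear functional `φ ↦ ∫ D ∂ᵢφ` on `H¹_#(Y)/ℝ`. -/
def partialFunctional (D : C(Cell n, ℝ)) (i : Fin n) : H1perModConst n →L[ℝ] ℝ :=
  (innerSL ℝ (ContinuousMap.toLp 2 (cellMeasure n) ℝ D)).comp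
    ((PiLp.proj 2 (fun _ : Fin n => CellL2 n) i).comp (weakGradL n))

theorem partialFunctional_apply (D : C(Cell n, ℝ)) (i : Fin n) (φ : H1perModConst n) :
    partialFunctional D i φ = ∫ y, D y * weakGrad φ i y ∂(cellMeasure n) := by
  simp only [mul_comm (D _)]
  exact (integral_mul_eq_inner _ _).symm

/-- The bilinear form `(w, φ) ↦ ∫ D ∑ₖₗ aₖₗ ∂ₖw ∂ₗφ` on `H¹_#(Y)/ℝ` with constant
coefficients `a`. -/
def coeffForm (D : C(Cell n, ℝ)) (a : Matrix (Fin n) (Fin n) ℝ) :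
    H1perModConst n →L[ℝ] H1perModConst n →L[ℝ] ℝ :=
  ∑ k, ∑ l, a k l • partialForm D k l

theorem coeffForm_apply (D : C(Cell n, ℝ)) (a : Matrix (Fin n) (Fin n) ℝ)
    (w φ : H1perModConst n) :
    coeffForm D a w φ = ∫ y, D y * ∑ k, ∑ l, a k l * (weakGrad w k y * weakGrad φ l y)
      ∂(cellMeasure n) := by
  have hint : ∀ k l : Fin n, Integrable
      (fun y => a k l * (D y * (weakGrad w k y * weakGrad φ l y))) (cellMeasure n) :=
    fun k l => (integrable_weight_mul D _ _).const_mul _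
  simp only [coeffForm, sum_apply, smul_apply,
    smul_eq_mul, partialForm_apply, Finset.mul_sum, mul_left_comm (D _) (a _ _)]
  rw [integral_finsetSum _ fun k _ => integrable_finsetSum _ fun l _ => hint k l]
  refine Finset.sum_congr rfl fun k _ => ?_
  rw [integral_finsetSum _ fun l _ => hint k l]
  refine Finset.sum_congr rfl fun l _ => ?_
  rw [integral_const_mul]

open Matrix in
/-- `g(v, ∇p) = ∑ₖ vᵏ pₖ`: the metric lowers the index that the gradient raises. -/
theorem metricInner_metricGrad {G : Matrix (Fin n) (Fin n) ℝ} (hG : G.PosDef) (v p : Fin n → ℝ) :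
    metricInner G v (metricGrad G p) = ∑ k, v k * p k := by
  have h1 : metricInner G v (metricGrad G p) = v ⬝ᵥ (G *ᵥ (G⁻¹ *ᵥ p)) := by
    simp only [metricInner, metricGrad, dotProduct, mulVec, Finset.mul_sum]
    refine Finset.sum_congr rfl fun i _ => Finset.sum_congr rfl fun j _ =>
      Finset.sum_congr rfl fun l _ => by ring
  rw [h1, mulVec_mulVec, mul_nonsing_inv _ ((isUnit_iff_isUnit_det _).1 hG.isUnit), one_mulVec]
  rfl

/-- The weak cell problem as an equation between functionals on `H¹_#(Y)/ℝ`. -/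
theorem isCellSolution_iff (D : C(Cell n, ℝ)) {G : Matrix (Fin n) (Fin n) ℝ} (hG : G.PosDef)
    (i : Fin n) (w : H1perModConst n) :
    IsCellSolution D G i w ↔ coeffForm D G⁻¹ w = -partialFunctional D i := by
  rw [ContinuousLinearMap.ext_iff]
  refine forall_congr' fun φ => ?_
  have hsymm : ∀ k l, G⁻¹ k l = G⁻¹ l k := fun k l => hG.inv.isHermitian.apply l k
  rw [coeffForm_apply, neg_apply, partialFunctional_apply]
  simp only [metricInner_metricGrad hG, metricGrad, Finset.sum_mul]
  simp only [Pi.single_apply, ite_mul, one_mul, zero_mul, Finset.sum_ite_eq', Finset.mem_univ,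
    if_true]
  rw [iff_iff_eq]
  congr 2
  funext y
  rw [Finset.sum_comm]
  simp only [hsymm, mul_assoc]

/-- A positive definite matrix is uniformly elliptic. -/
theorem exists_ellipticity {a : Matrix (Fin n) (Fin n) ℝ} (ha : a.PosDef) :
    ∃ c : ℝ, 0 < c ∧ ∀ p : Fin n → ℝ, c * ∑ k, p k ^ 2 ≤ ∑ k, ∑ l, a k l * (p k * p l) := by
  let q : EuclideanSpace ℝ (Fin n) → ℝ := fun p => ∑ k, ∑ l, a k l * (p k * p l)
  have hq : Continuous q := by fun_prop
  have hpos : ∀ p, p ≠ 0 → 0 < q p := by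
    intro p hp
    have h := ha.dotProduct_mulVec_pos (x := p.ofLp) (by simpa using hp)
    convert! h using 1
    simp only [q, dotProduct, Matrix.mulVec, Finset.mul_sum, star_trivial]
    exact Finset.sum_congr rfl fun i _ => Finset.sum_congr rfl fun j _ => by ring
  have hsphere : ∃ c : ℝ, 0 < c ∧ ∀ p : EuclideanSpace ℝ (Fin n), ‖p‖ = 1 → c ≤ q p := by
    by_cases hne : (Metric.sphere (0 : EuclideanSpace ℝ (Fin n)) 1).Nonempty
    · obtain ⟨p₀, hp₀, hmin⟩ := (isCompact_sphere _ _).exists_isMinOn hne hq.continuousOn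
      refine ⟨q p₀, hpos _ (ne_zero_of_mem_unit_sphere ⟨p₀, hp₀⟩), fun p hp => hmin ?_⟩
      simpa using hp
    · exact ⟨1, one_pos, fun p hp => (hne ⟨p, by simpa using hp⟩).elim⟩
  obtain ⟨c, hc, hle⟩ := hsphere
  refine ⟨c, hc, fun p => ?_⟩
  by_cases hp : p = 0
  · simp [hp]
  set P : EuclideanSpace ℝ (Fin n) := WithLp.toLp 2 p with hP
  have hP0 : 0 < ‖P‖ := norm_pos_iff.2 (by simpa [hP] using hp)
  have h1 := hle (‖P‖⁻¹ • P) (by rw [norm_smul, norm_inv, norm_norm, inv_mul_cancel₀ hP0.ne'])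
  have h2 : q (‖P‖⁻¹ • P) = ‖P‖⁻¹ ^ 2 * q P := by
    simp only [q, Finset.mul_sum, PiLp.smul_apply, smul_eq_mul]
    exact Finset.sum_congr rfl fun i _ => Finset.sum_congr rfl fun j _ => by ring
  have h3 : ‖P‖ ^ 2 = ∑ k, p k ^ 2 := EuclideanSpace.real_norm_sq_eq P
  rw [h2, inv_pow, inv_mul_eq_div, le_div_iff₀ (by positivity), h3] at h1
  exact h1

/-- Coercivity is measured by the norm of the weak gradient. -/
theorem coeffForm_coercive {D : C(Cell n, ℝ)} {d₀ : ℝ} (hd₀ : 0 < d₀) (hD : ∀ y, d₀ ≤ D y)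
    {a : Matrix (Fin n) (Fin n) ℝ} (ha : a.PosDef) :
    ∃ c : ℝ, 0 < c ∧ ∀ w, c * ‖weakGradL n w‖ ^ 2 ≤ coeffForm D a w w := by
  obtain ⟨c, hc, hle⟩ := exists_ellipticity ha
  refine ⟨d₀ * c, mul_pos hd₀ hc, fun w => ?_⟩
  have hsq : ∀ k, Integrable (fun y => weakGrad w k y ^ 2) (cellMeasure n) :=
    fun k => (Lp.memLp (weakGrad w k)).integrable_sq
  have hint : Integrable (fun y => ∑ k, weakGrad w k y ^ 2) (cellMeasure n) :=
    integrable_finsetSum _ fun k _ => hsq k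
  rw [coeffForm_apply, weakGradL_apply, PiLp.norm_sq_eq_of_L2]
  simp only [norm_sq_eq_integral]
  rw [← integral_finsetSum _ fun k _ => hsq k, ← integral_const_mul]
  refine integral_mono (hint.const_mul _) ?_ fun y => ?_
  · simp only [Finset.mul_sum, mul_left_comm (D _) (a _ _)]
    exact integrable_finsetSum _ fun k _ => integrable_finsetSum _ fun l _ =>
      (integrable_weight_mul D _ _).const_mul _
  · have h1 := hle fun k => weakGrad w k y
    have h2 : 0 ≤ c * ∑ k, weakGrad w k y ^ 2 := by positivity
    calc d₀ * c * ∑ k, weakGrad w k y ^ 2 = d₀ * (c * ∑ k, weakGrad w k y ^ 2) := by ring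
      _ ≤ D y * (c * ∑ k, weakGrad w k y ^ 2) := mul_le_mul_of_nonneg_right (hD y) h2
      _ ≤ _ := mul_le_mul_of_nonneg_left h1 (hd₀.le.trans (hD y))

theorem isInvertible_coeffForm {D : C(Cell n, ℝ)} {d₀ : ℝ} (hd₀ : 0 < d₀) (hD : ∀ y, d₀ ≤ D y)
    {a : Matrix (Fin n) (Fin n) ℝ} (ha : a.PosDef) : (coeffForm D a).IsInvertible := by
  obtain ⟨c, hc, hle⟩ := coeffForm_coercive hd₀ hD ha
  have hT : ∀ w : H1perModConst n, ‖w‖ ≤ 2 * ‖weakGradL n w‖ := norm_le_norm_weakGrad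
  exact isInvertible_of_coercive (weakGradL n) hT (coeffForm D a) hc hle

/-- The solution of the cell problem for the metric with coefficients `G`. It is meaningful only for
positive definite `G`, as `ContinuousLinearMap.inverse` is zero on operators that are not
invertible. -/
def cellSolution (D : C(Cell n, ℝ)) (G : Matrix (Fin n) (Fin n) ℝ) (i : Fin n) :
    H1perModConst n :=
  (coeffForm D G⁻¹).inverse (-partialFunctional D i)

theorem isCellSolution_iff_eq {D : C(Cell n, ℝ)} {d₀ : ℝ} (hd₀ : 0 < d₀) (hD : ∀ y, d₀ ≤ D y)
    {G : Matrix (Fin n) (Fin n) ℝ} (hG : G.PosDef) (i : Fin n) (v : H1perModConst n) :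
    IsCellSolution D G i v ↔ v = cellSolution D G i := by
  rw [isCellSolution_iff D hG]
  obtain ⟨e, he⟩ := isInvertible_coeffForm hd₀ hD hG.inv
  rw [cellSolution, ← he, ContinuousLinearMap.inverse_equiv]
  exact (e.toEquiv.eq_symm_apply).symm

/-! ### Smooth dependence of the solution on the metric -/

theorem contDiff_det {E : Type*} [NormedAddCommGroup E] [NormedSpace ℝ E] {m : WithTop ℕ∞}
    {A : E → Matrix (Fin n) (Fin n) ℝ} (hA : ∀ i j, ContDiff ℝ m fun x => A x i j) :
    ContDiff ℝ m fun x => (A x).det := by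
  simp only [Matrix.det_apply]
  exact ContDiff.sum fun σ _ => (contDiff_prod fun i _ => hA _ _).const_smul _

theorem contDiffAt_matrix_inv_apply {m : WithTop ℕ∞} {G : Fin n → Fin n → ℝ}
    (hG : (Matrix.of G).det ≠ 0) (k l : Fin n) :
    ContDiffAt ℝ m (fun G : Fin n → Fin n → ℝ => (Matrix.of G)⁻¹ k l) G := by
  have hentry : ∀ i j : Fin n, ContDiff ℝ m fun G : Fin n → Fin n → ℝ => Matrix.of G i j :=
    fun i j => contDiff_apply_apply ℝ ℝ i j
  have hdet : ContDiff ℝ m fun G : Fin n → Fin n → ℝ => (Matrix.of G).det := contDiff_det hentry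
  have hadj : ContDiff ℝ m fun G : Fin n → Fin n → ℝ => (Matrix.of G).adjugate k l := by
    simp only [Matrix.adjugate_apply]
    refine contDiff_det fun i j => ?_
    by_cases hi : i = l
    · simpa [Matrix.updateRow_apply, hi] using contDiff_const
    · simpa [Matrix.updateRow_apply, hi] using hentry i j
  simp only [Matrix.inv_def, Matrix.smul_apply, Ring.inverse_eq_inv', smul_eq_mul]
  exact (hdet.contDiffAt.inv hG).mul hadj.contDiffAt

theorem contDiffAt_sum_smul {Y P : Type*} [NormedAddCommGroup Y] [NormedSpace ℝ Y]
    [NormedAddCommGroup P] [NormedSpace ℝ P] {m : WithTop ℕ∞}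
    {a : P → Fin n → Fin n → ℝ} {p : P} (b : Fin n → Fin n → Y)
    (ha : ∀ k l, ContDiffAt ℝ m (fun p => a p k l) p) :
    ContDiffAt ℝ m (fun p => ∑ k, ∑ l, a p k l • b k l) p :=
  ContDiffAt.sum fun k _ => ContDiffAt.sum fun l _ => (ha k l).smul contDiffAt_const

/-- The solution of a variational equation depends smoothly on the coefficients of the bilinear
form, since inversion of operators between Banach spaces is smooth. -/
theorem contDiffAt_inverse_sum {X P : Type*} [NormedAddCommGroup X] [NormedSpace ℝ X]
    [CompleteSpace X] [NormedAddCommGroup P] [NormedSpace ℝ P] {m : WithTop ℕ∞}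
    {a : P → Fin n → Fin n → ℝ} {p : P} (b : Fin n → Fin n → X →L[ℝ] X →L[ℝ] ℝ)
    (f : X →L[ℝ] ℝ) (ha : ∀ k l, ContDiffAt ℝ m (fun p => a p k l) p)
    (hp : (∑ k, ∑ l, a p k l • b k l).IsInvertible) :
    ContDiffAt ℝ m (fun p => (∑ k, ∑ l, a p k l • b k l).inverse f) p := by
  have hsum : ContDiffAt ℝ m (fun p => ∑ k, ∑ l, a p k l • b k l) p :=
    contDiffAt_sum_smul b ha
  have hinv : ContDiffAt ℝ m ContinuousLinearMap.inverse (∑ k, ∑ l, a p k l • b k l) :=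
    hp.contDiffAt_map_inverse
  exact (hinv.comp p hsum).clm_apply contDiffAt_const

theorem contDiffAt_cellSolution {m : WithTop ℕ∞} {D : C(Cell n, ℝ)} {d₀ : ℝ} (hd₀ : 0 < d₀)
    (hD : ∀ y, d₀ ≤ D y) (i : Fin n) {G : Fin n → Fin n → ℝ} (hG : (Matrix.of G).PosDef) :
    ContDiffAt ℝ m (fun G : Fin n → Fin n → ℝ => cellSolution D (Matrix.of G) i) G := by
  simp only [cellSolution, coeffForm]
  exact contDiffAt_inverse_sum (partialForm D) (-partialFunctional D i)
    (fun k l => contDiffAt_matrix_inv_apply hG.det_pos.ne' k l)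
    (isInvertible_coeffForm hd₀ hD hG.inv)

end Form

/-! ### The coefficients of the metric in a chart -/

section Chart

variable {n : ℕ} {H : Type*} [TopologicalSpace H]
  {I : ModelWithCorners ℝ (EuclideanSpace ℝ (Fin n)) H}
  {M : Type*} [TopologicalSpace M] [ChartedSpace H M]

theorem CoordChart.posDef_metricCoeff [IsManifold I ∞ M] (φ : CoordChart I M)
    (g : Bundle.ContMDiffRiemannianMetric I ∞ (EuclideanSpace ℝ (Fin n))
      (fun x : M => TangentSpace I x)) {x : M} (hx : x ∈ φ.source) :
    (φ.metricCoeff g x).PosDef := by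
  obtain ⟨e, he⟩ := φ.isInvertible_mfderiv x hx
  have hbasis : ∀ i, φ.basisVec x i = e.symm (EuclideanSpace.single i (1 : ℝ)) := by
    intro i
    rw [CoordChart.basisVec, ← he, ContinuousLinearMap.inverse_equiv]
    rfl
  refine Matrix.PosDef.of_dotProduct_mulVec_pos ?_ fun p hp => ?_
  · ext i j
    exact g.symm x _ _
  · have hu : (WithLp.toLp 2 p : EuclideanSpace ℝ (Fin n)) =
        ∑ i, p i • EuclideanSpace.single i (1 : ℝ) := by
      ext j
      simp [Pi.single_apply]
    set v : TangentSpace I x := e.symm (WithLp.toLp 2 p) with hev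
    have hv : v = ∑ i, p i • φ.basisVec x i := by
      refine (congrArg e.symm hu).trans ((map_sum e.symm _ _).trans ?_)
      exact Finset.sum_congr rfl fun i _ => by rw [hbasis i]; exact map_smul e.symm _ _
    have hv0 : v ≠ 0 := by
      intro h0
      have h1 := e.symm.map_eq_zero_iff.1 h0
      exact hp (congrArg WithLp.ofLp h1)
    have h2 : star p ⬝ᵥ (φ.metricCoeff g x).mulVec p = g.inner x v v := by
      simp only [hv, map_sum, map_smul, sum_apply, smul_apply, smul_eq_mul]
      simp only [dotProduct, Matrix.mulVec, star_trivial, Finset.mul_sum]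
      rw [Finset.sum_comm]
      refine Finset.sum_congr rfl fun i _ => Finset.sum_congr rfl fun j _ => ?_
      simp only [CoordChart.metricCoeff, Matrix.of_apply]
      ring
    rw [h2]
    exact g.pos x v hv0

/-- The coordinate field `∂/∂xⁱ` is the pullback of a constant vector field on `ℝⁿ`. -/
theorem CoordChart.contMDiffAt_basisVec [IsManifold I ∞ M] (φ : CoordChart I M) {x : M}
    (hx : x ∈ φ.source) (i : Fin n) :
    ContMDiffAt I I.tangent 1
      (fun x => (⟨x, φ.basisVec x i⟩ : TangentBundle I M)) x := by
  have : IsManifold I 1 M := IsManifold.of_le (n := ∞) (by simp)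
  refine ContMDiffAt.mpullback_vectorField_preimage (n := ∞)
    (I' := 𝓘(ℝ, EuclideanSpace ℝ (Fin n))) (f := φ.toFun)
    (V := fun _ => EuclideanSpace.single i (1 : ℝ)) ?_
    (φ.contMDiffOn.contMDiffAt (φ.isOpen_source.mem_nhds hx)) (φ.isInvertible_mfderiv x hx) ?_
  · exact contMDiffAt_vectorSpace_iff_contDiffAt.2 contDiffAt_const
  · exact WithTop.coe_le_coe.2 (le_top : (1 + 1 : ℕ∞) ≤ ⊤)

theorem CoordChart.contMDiffAt_metricCoeff [IsManifold I ∞ M] (φ : CoordChart I M)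
    (g : Bundle.ContMDiffRiemannianMetric I ∞ (EuclideanSpace ℝ (Fin n))
      (fun x : M => TangentSpace I x)) {x : M} (hx : x ∈ φ.source) (i j : Fin n) :
    ContMDiffAt I 𝓘(ℝ, ℝ) 1 (fun x => φ.metricCoeff g x i j) x := by
  have : IsManifold I 1 M := IsManifold.of_le (n := ∞) (by simp)
  have hg := (g.contMDiff x).of_le (m := 1) (by simp)
  have h : ContMDiffAt I (I.prod 𝓘(ℝ, ℝ)) 1
      (fun x => Bundle.TotalSpace.mk' ℝ (E := Bundle.Trivial M ℝ) x
        (g.inner x (φ.basisVec x i) (φ.basisVec x j))) x := by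
    apply ContMDiffAt.clm_bundle_apply₂ (F₁ := EuclideanSpace ℝ (Fin n))
      (F₂ := EuclideanSpace ℝ (Fin n))
    · exact hg
    · exact φ.contMDiffAt_basisVec hx i
    · exact φ.contMDiffAt_basisVec hx j
  simp only [Bundle.contMDiffAt_totalSpace] at h
  exact h.2

theorem CoordChart.basisVec_eq_of_add_const {φ ψ : CoordChart I M} {x : M} (hx : x ∈ ψ.source)
    {c : EuclideanSpace ℝ (Fin n)} (h : φ.toFun =ᶠ[nhds x] fun y => ψ.toFun y + c) (i : Fin n) :
    φ.basisVec x i = ψ.basisVec x i := by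
  have hψ : MDifferentiableAt I 𝓘(ℝ, EuclideanSpace ℝ (Fin n)) ψ.toFun x :=
    (ψ.contMDiffOn.contMDiffAt (ψ.isOpen_source.mem_nhds hx)).mdifferentiableAt (by simp)
  have h1 := (hψ.hasMFDerivAt.add (hasMFDerivAt_const c x)).mfderiv
  have h2 : mfderiv I 𝓘(ℝ, EuclideanSpace ℝ (Fin n)) φ.toFun x =
      mfderiv I 𝓘(ℝ, EuclideanSpace ℝ (Fin n)) ψ.toFun x :=
    (h.mfderiv_eq.trans h1).trans (add_zero _)
  unfold CoordChart.basisVec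
  exact congrArg (fun L : TangentSpace I x →L[ℝ] EuclideanSpace ℝ (Fin n) =>
    L.inverse (EuclideanSpace.single i (1 : ℝ))) h2

/-- Charts that differ by a translation on their overlap have the same coordinate vector fields,
and hence the same metric coefficients, there. -/
theorem CompatibleWithUnfolding.metricCoeff_eq [IsManifold I ∞ M] {ι : Type*}
    {A : ι → CoordChart I M} {S : Set ℝ} (hS : S.Nonempty) (hA : CompatibleWithUnfolding A S)
    (g : Bundle.ContMDiffRiemannianMetric I ∞ (EuclideanSpace ℝ (Fin n))
      (fun x : M => TangentSpace I x)) {α β : ι} {x : M}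
    (hα : x ∈ (A α).source) (hβ : x ∈ (A β).source) :
    (A α).metricCoeff g x = (A β).metricCoeff g x := by
  obtain ⟨ε, hε⟩ := hS
  obtain ⟨k, hk⟩ := hA α β ⟨x, hα, hβ⟩ ε hε
  have hnhds : (A α).source ∩ (A β).source ∈ nhds x :=
    ((A α).isOpen_source.inter (A β).isOpen_source).mem_nhds ⟨hα, hβ⟩
  have h : (A α).toFun =ᶠ[nhds x]
      fun y => (A β).toFun y + WithLp.toLp 2 fun i => ε * (k i : ℝ) := by
    filter_upwards [hnhds] with y hy
    ext i
    simpa using hk y hy i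
  ext i j
  simp only [CoordChart.metricCoeff, Matrix.of_apply, CoordChart.basisVec_eq_of_add_const hβ h]

end Chart

end CellProblem

end

theorem theorem3p4 {n : ℕ} {H : Type*} [TopologicalSpace H]
    (I : ModelWithCorners ℝ (EuclideanSpace ℝ (Fin n)) H)
    (M : Type*) [TopologicalSpace M] [ChartedSpace H M] [IsManifold I ∞ M]
    [CompactSpace M] [T2Space M]
    (g : Bundle.ContMDiffRiemannianMetric I ∞ (EuclideanSpace ℝ (Fin n))
      (fun x : M => TangentSpace I x))
    {ι : Type*} [Finite ι] (A : ι → CellProblem.CoordChart I M)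
    (hcover : ∀ x, ∃ α, x ∈ (A α).source)
    (S : Set ℝ) (hS : S.Nonempty) (hSpos : ∀ ε ∈ S, 0 < ε)
    (hUC : CellProblem.CompatibleWithUnfolding A S)
    (D : C(CellProblem.Cell n, ℝ)) (d₀ D₀ : ℝ) (hd₀ : 0 < d₀)
    (hD : ∀ y, d₀ ≤ D y ∧ D y ≤ D₀) :
    ∃ w : Fin n → M → CellProblem.H1perModConst n,
      (∀ i x α, x ∈ (A α).source → ∀ v : CellProblem.H1perModConst n,
        CellProblem.IsCellSolution D ((A α).metricCoeff g x) i v ↔ v = w i x) ∧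
      ∀ i, ContMDiff I 𝓘(ℝ, CellProblem.H1perModConst n) 1 (w i) := by
  have hDd : ∀ y, d₀ ≤ D y := fun y => (hD y).1
  choose α hα using hcover
  refine ⟨fun i x => CellProblem.cellSolution D ((A (α x)).metricCoeff g x) i, ?_, ?_⟩
  · intro i x β hβ v
    rw [hUC.metricCoeff_eq hS g hβ (hα x)]
    exact CellProblem.isCellSolution_iff_eq hd₀ hDd ((A (α x)).posDef_metricCoeff g (hα x)) i v
  · intro i x
    have hcoeff : ContMDiffAt I 𝓘(ℝ, Fin n → Fin n → ℝ) 1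
        (fun y k l => (A (α x)).metricCoeff g y k l) x :=
      contMDiffAt_pi_space.2 fun k => contMDiffAt_pi_space.2 fun l =>
        (A (α x)).contMDiffAt_metricCoeff g (hα x) k l
    have hsol := CellProblem.contDiffAt_cellSolution (m := 1) hd₀ hDd i
      (G := fun k l => (A (α x)).metricCoeff g x k l) ((A (α x)).posDef_metricCoeff g (hα x))
    refine (hsol.comp_contMDiffAt hcoeff).congr_of_eventuallyEq ?_
    -- Near `x` the chosen charts may be replaced by the one chosen at `x`.
    filter_upwards [(A (α x)).isOpen_source.mem_nhds (hα x)] with y hy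
    rw [hUC.metricCoeff_eq hS g (hα y) hy]
    rfl
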